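/- Conventions. In a small category $\mathcal C$, compositions are written in path order: $x\xrightarrow{f}y\xrightarrow{g}z$ composes to $fg$. For an object $x$ let $\mathcal C_{x\to}$ (resp. $\mathcal C_{\to x}$) be the set of morphisms with source (resp. target) $x$, ordered by $f\preceq g$ iff $g=fh$ for some morphism $h$ (resp. $g\succeq f$ iff $g=hf$ for some morphism $h$). An atom is a non-invertible morphism that is not a product of two non-invertible morphisms. $\mathcal C$ is cancellative if $afb=agb$ implies $f=g$, and homogeneous if there is $l:\mathrm{Mor}(\mathcal C)\to\mathbb Z_{\ge 0}$ with $l(fg)=l(f)+l(g)$ and $l(f)=0$ iff $f$ is invertible. A homogeneous categorical Garside structure is a triple $(\mathcal C,\phi,\Delta)$, where $\mathcal C$ is a homogeneous cancellative small category, $\phi$ is an automorphism of $\mathcal C$, and $\Delta$ is a natural transformation from $1_{\mathcal C}$ to $\phi$ with components $\Delta_x:x\to\phi(x)$, such that all atoms are simple and, for every object $x$, both $\mathcal C_{x\to}$ and $\mathcal C_{\to x}$ are lattices (in particular partially ordered sets) for the above orders. Here a morphism $f:x\to y$ is simple if $ff^*=\Delta_x$ for some $f^*:y\to\phi(x)$;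 let $S$ be the set of simple morphisms. Let $\mathcal G$ be the enveloping groupoid of $\mathcal C$ (obtained by formally inverting all morphisms), let $x$ be an object, and let $G_x$ be the associated weak Garside group, i.e. the group of morphisms of $\mathcal G$ from $x$ to $x$. Let $L_x$ be the set of all morphisms of $\mathcal G$ with source $x$. The weak Cayley graph $\mathrm{Cay}(G_x,S)$ is the simple graph with vertex set $L_x$ in which two distinct vertices $f,g$ are adjacent iff $f=gs$ or $g=fs$ for some $s\in S$. The Garside automorphism is the bijection $f\mapsto\Delta_x\phi(f)$ of $L_x$; let $\langle\Delta_x\rangle$ denote the cyclic group it generates. The quotient $\mathrm{Cay}(G_x,S)/\langle\Delta_x\rangle$ is the simple graph whose vertices are the $\langle\Delta_x\rangle$-orbits in $L_x$, two distinct orbits being adjacent iff they have representatives adjacent in $\mathrm{Cay}(G_x,S)$. A simple graph with path metric $d$ is weakly modular if it is connected and, for every vertex $p$ and every integer $n\ge 2$: 1. for any two adjacent vertices $x_1,x_2$ with $d(p,x_1)=d(p,x_2)=n$ there is a vertex $y$ with $d(y,p)=n-1$ and $d(y,x_1)=d(y,x_2)=1$; 2. for any two vertices $x_1,x_2$ with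 $d(p,x_1)=d(p,x_2)=n$ and $d(x_1,x_2)=2$ that have a common neighbour at distance $n+1$ from $p$, there is a vertex $y$ with $d(y,p)=n-1$ and $d(y,x_1)=d(y,x_2)=1$. **Theorem 5.7 (Theorem D).** Let $(\mathcal C,\phi,\Delta)$ be a homogeneous categorical Garside structure, $x$ an object of $\mathcal C$, and $G_x$ the associated weak Garside group, with set of simple morphisms $S$. Then the weak Cayley graph $\mathrm{Cay}(G_x,S)$ and its quotient $\mathrm{Cay}(G_x,S)/\langle\Delta_x\rangle$ are weakly modular graphs. -/

import Mathlib

open CategoryTheory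

universe v u

/-- A simplicial graph is weakly modular if it is connected (so that the path metric `dist` is an
honest metric) and satisfies the triangle condition and the quadrangle condition at every vertex. -/
structure SimpleGraph.IsWeaklyModular {V : Type*} (Γ : SimpleGraph V) : Prop where
  connected : Γ.Connected
  triangle : ∀ (x : V) (n : ℕ), 2 ≤ n → ∀ x₁ x₂ : V, Γ.Adj x₁ x₂ →
    Γ.dist x x₁ = n → Γ.dist x x₂ = n →
    ∃ y : V, Γ.dist y x = n - 1 ∧ Γ.dist y x₁ = 1 ∧ Γ.dist y x₂ = 1
  quadrangle : ∀ (x : V) (n : ℕ), 2 ≤ n → ∀ x₁ x₂ : V,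
    Γ.dist x x₁ = n → Γ.dist x x₂ = n → Γ.dist x₁ x₂ = 2 →
    (∃ t : V, Γ.Adj x₁ t ∧ Γ.Adj x₂ t ∧ Γ.dist x t = n + 1) →
    ∃ y : V, Γ.dist y x = n - 1 ∧ Γ.dist y x₁ = 1 ∧ Γ.dist y x₂ = 1

/-- The quotient of a simplicial graph by a group acting on its vertices: the vertices are the
orbits, and two distinct orbits are adjacent if they have adjacent representatives. -/
def SimpleGraph.orbitQuotient {V : Type*} (Γ : SimpleGraph V) (H : Type*) [Group H]
    [MulAction H V] : SimpleGraph (MulAction.orbitRel.Quotient H V) where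
  Adj p q := p ≠ q ∧ ∃ a b : V, (Quotient.mk _ a : MulAction.orbitRel.Quotient H V) = p ∧
    (Quotient.mk _ b : MulAction.orbitRel.Quotient H V) = q ∧ Γ.Adj a b
  symm := ⟨fun _ _ ⟨hne, a, b, ha, hb, hab⟩ => ⟨hne.symm, b, a, hb, ha, hab.symm⟩⟩
  loopless := ⟨fun _ h => h.1 rfl⟩

namespace GarsideCat

section Category

variable (C : Type u) [Category.{v} C]

/-- `C` is cancellative: `afb = agb` implies `f = g`. -/
def IsCancellative : Prop :=
  ∀ ⦃w x y z : C⦄ (a : w ⟶ x) (f g : x ⟶ y) (b : y ⟶ z), a ≫ f ≫ b = a ≫ g ≫ b → f = g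

/-- `C` is homogeneous: there is an additive length function on morphisms with values in `ℕ` that
vanishes exactly on the units. -/
def IsHomogeneous : Prop :=
  ∃ l : ∀ ⦃x y : C⦄, (x ⟶ y) → ℕ,
    (∀ ⦃x y z : C⦄ (f : x ⟶ y) (g : y ⟶ z), l (f ≫ g) = l f + l g) ∧
    (∀ ⦃x y : C⦄ (f : x ⟶ y), l f = 0 ↔ IsIso f)

variable {C}

/-- The set `C_{x →}` of morphisms with source `x`. -/
abbrev MorphismsFrom (x : C) : Type max u v := Σ y : C, (x ⟶ y)

/-- The set `C_{→ y}` of morphisms with target `y`. -/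
abbrev MorphismsTo (y : C) : Type max u v := Σ x : C, (x ⟶ y)

/-- The relation `f ≼ g` on `C_{x →}`: there is `h` with `g = f h`. -/
def PrefixLE {x : C} (f g : MorphismsFrom x) : Prop :=
  ∃ h : f.1 ⟶ g.1, g.2 = f.2 ≫ h

/-- The relation `g ≽ f` on `C_{→ y}`: there is `h` with `g = h f`. -/
def SuffixLE {y : C} (f g : MorphismsTo y) : Prop :=
  ∃ h : g.1 ⟶ f.1, g.2 = h ≫ f.2

/-- A nontrivial morphism that is not a product of two nontrivial morphisms. -/
def IsAtom {x y : C} (f : x ⟶ y) : Prop :=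
  ¬ IsIso f ∧ ∀ ⦃z : C⦄ (g : x ⟶ z) (h : z ⟶ y), f = g ≫ h → IsIso g ∨ IsIso h

/-- The relation `r` is the order relation of a lattice (in particular, it is a partial order). -/
def IsLatticeOrder {α : Type*} (r : α → α → Prop) : Prop :=
  ∃ _ : Lattice α, ∀ a b : α, a ≤ b ↔ r a b

end Category

/-- A homogeneous categorical Garside structure `(C, φ, Δ)`. The inverse of the automorphism `φ` is
recorded as `phiInv`. A morphism `f : x ⟶ y` is simple if `f f' = Δ_x` for some `f' : y ⟶ φ x`. -/
structure GarsideStructure (C : Type u) [Category.{v} C] where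
  phi : C ⥤ C
  phiInv : C ⥤ C
  phi_comp_phiInv : phi ⋙ phiInv = 𝟭 C
  phiInv_comp_phi : phiInv ⋙ phi = 𝟭 C
  Delta : 𝟭 C ⟶ phi
  homogeneous : IsHomogeneous C
  cancellative : IsCancellative C
  atom_simple : ∀ ⦃x y : C⦄ (f : x ⟶ y), IsAtom f →
    ∃ f' : y ⟶ phi.obj x, f ≫ f' = Delta.app x
  lattice_from : ∀ x : C, IsLatticeOrder (PrefixLE (x := x))
  lattice_to : ∀ y : C, IsLatticeOrder (SuffixLE (y := y))

namespace GarsideStructure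

variable {C : Type u} [Category.{v} C] (D : GarsideStructure C)

/-- The morphism `Δ_x : x ⟶ φ x`. -/
def delta (x : C) : x ⟶ D.phi.obj x := D.Delta.app x

/-- Membership in the set `S` of simple morphisms. -/
def IsSimple {x y : C} (f : x ⟶ y) : Prop :=
  ∃ f' : y ⟶ D.phi.obj x, f ≫ f' = D.delta x

/-- The set `L_x` of morphisms from `x` in the enveloping groupoid of `C` (whose objects are those
of `C`). -/
abbrev L (_D : GarsideStructure C) (x : C) : Type max u v :=
  Σ y : C, (FreeGroupoid.mk x ⟶ FreeGroupoid.mk y)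

/-- The weak Cayley graph `Cay(G_x, S)`: the vertex set is `L_x`, and two distinct vertices `f`, `g`
are adjacent if `f = g s` or `g = f s` for some simple morphism `s`. -/
def weakCayleyGraph (x : C) : SimpleGraph (D.L x) :=
  SimpleGraph.fromRel fun f g => ∃ s : f.1 ⟶ g.1, D.IsSimple s ∧ g.2 = f.2 ≫ FreeGroupoid.homMk s

/-- The action of `φ` on the morphisms of the enveloping groupoid. -/
def phiMap {x y : C} (f : FreeGroupoid.mk x ⟶ FreeGroupoid.mk y) :
    FreeGroupoid.mk (D.phi.obj x) ⟶ FreeGroupoid.mk (D.phi.obj y) :=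
  (FreeGroupoid.map D.phi).map f

/-- The map `f ↦ Δ_x φ(f)` of `L_x`. -/
def garsideMap (x : C) (f : D.L x) : D.L x :=
  ⟨D.phi.obj f.1, FreeGroupoid.homMk (D.delta x) ≫ D.phiMap f.2⟩

/-- `Δ` is natural with respect to the morphisms of the enveloping groupoid. -/
theorem delta_natural {x y : C} (f : FreeGroupoid.mk x ⟶ FreeGroupoid.mk y) :
    FreeGroupoid.homMk (D.delta x) ≫ D.phiMap f = f ≫ FreeGroupoid.homMk (D.delta y) := by
  let τ : FreeGroupoid.of C ⋙ 𝟭 (FreeGroupoid C) ≅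
      FreeGroupoid.of C ⋙ FreeGroupoid.map D.phi :=
    NatIso.ofComponents (fun z => Groupoid.isoEquivHom _ _ |>.symm
        (FreeGroupoid.homMk (D.delta z)))
      (fun {a b} g => by
        change (FreeGroupoid.of C).map g ≫ (FreeGroupoid.of C).map (D.Delta.app b) =
          (FreeGroupoid.of C).map (D.Delta.app a) ≫ (FreeGroupoid.of C).map (D.phi.map g)
        rw [← Functor.map_comp, ← Functor.map_comp, ← D.Delta.naturality]
        rfl)
  have h := (FreeGroupoid.liftNatIso (𝟭 (FreeGroupoid C)) (FreeGroupoid.map D.phi) τ).hom.naturality f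
  rw [FreeGroupoid.liftNatIso_hom_app, FreeGroupoid.liftNatIso_hom_app] at h
  exact h.symm

/-- The map `f ↦ Δ_x φ(f)` is also the map `f ↦ f Δ_y`, where `y` is the target of `f`. -/
theorem garsideMap_eq (x : C) (f : D.L x) :
    D.garsideMap x f = ⟨D.phi.obj f.1, f.2 ≫ FreeGroupoid.homMk (D.delta f.1)⟩ := by
  rw [garsideMap, D.delta_natural]

theorem phi_obj_bijective : Function.Bijective D.phi.obj :=
  ⟨fun a b h => by
      have ha := Functor.congr_obj D.phi_comp_phiInv a
      have hb := Functor.congr_obj D.phi_comp_phiInv b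
      simp only [Functor.comp_obj, Functor.id_obj] at ha hb
      rw [← ha, ← hb, h],
    fun a => ⟨D.phiInv.obj a, Functor.congr_obj D.phiInv_comp_phi a⟩⟩

theorem garsideMap_bijective (x : C) : Function.Bijective (D.garsideMap x) := by
  constructor
  · rintro ⟨y, f⟩ ⟨z, g⟩ h
    have hyz : y = z := D.phi_obj_bijective.1 (congrArg Sigma.fst h)
    subst hyz
    simp only [garsideMap_eq, Sigma.mk.injEq, heq_eq_eq, true_and] at h
    rw [(cancel_mono _).1 h]
  · rintro ⟨z, g⟩
    obtain ⟨y, rfl⟩ := D.phi_obj_bijective.2 z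
    refine ⟨⟨y, g ≫ Groupoid.inv (FreeGroupoid.homMk (D.delta y))⟩, ?_⟩
    simp [garsideMap_eq]

/-- The Garside automorphism `f ↦ Δ_x φ(f)` of `Cay(G_x, S)`, as a permutation of the vertices. -/
noncomputable def garsideAutomorphism (x : C) : Equiv.Perm (D.L x) :=
  Equiv.ofBijective (D.garsideMap x) (D.garsideMap_bijective x)

/-- The quotient of `Cay(G_x, S)` by the cyclic group generated by the Garside automorphism. -/
noncomputable def weakCayleyGraphQuotient (x : C) :
    SimpleGraph (MulAction.orbitRel.Quotient (Subgroup.zpowers (D.garsideAutomorphism x))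
      (D.L x)) :=
  (D.weakCayleyGraph x).orbitQuotient (Subgroup.zpowers (D.garsideAutomorphism x))

end GarsideStructure

end GarsideCat

/-! Order $L_x$ by $f\le g$ iff $g=fs$ with $s$ in $\mathcal C$. Joins in $\mathcal C_{\to y}$ give
common left multiples, so $\mathcal C$ embeds in its groupoid and every groupoid morphism is a
fraction $s^{-1}g$. Hence any two elements of $L_x$ have a common lower bound $h$, and the part of
$L_x$ above $h$ is a copy of a lattice $\mathcal C_{z\to}$; so $L_x$ is a lattice. The Garside
automorphism $\tau$, which is $f\mapsto f\Delta$, is an order automorphism that moves elements up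
and has cofinal iterates. Edges of the Cayley graph join distinct $y,z$ with $y\le z\le\tau y$, up
to exchanging them.

The rest is lattice theory (`IsGarsideShift`). The distance from $p$ to $y$ is $a+b$, with $a,b\ge
0$ least such that $\tau^{-b}p\le y\le\tau^a p$; in the quotient, the $n$-ball about the orbit of
$p$ consists of the orbits meeting $[p,\tau^n p]$. The vertex required by either condition is a meet
of given vertices with a translate of $p$ one step lower, or a join with a translate one step
higher. -/

/-! ### Weak modularity through metric balls -/

/-- Weak modularity of a graph from a description of its metric balls: `ball p n` is the closed ball
of radius `n` about `p`, and `close` is the reflexive closure of adjacency. -/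
theorem SimpleGraph.isWeaklyModular_of_ball {V : Type*} [Nonempty V] (Γ : SimpleGraph V)
    (close : V → V → Prop) (ball : V → ℕ → V → Prop)
    (adj_iff : ∀ y z, Γ.Adj y z ↔ y ≠ z ∧ close y z)
    (close_refl : ∀ y, close y y)
    (ball_zero : ∀ p y, ball p 0 y ↔ y = p)
    (ball_succ : ∀ p n y z, close y z → ball p n y → ball p (n + 1) z)
    (exists_ball : ∀ p y, ∃ n, ball p n y)
    (triangle : ∀ p n y z, close y z → ball p (n + 1) y → ¬ ball p n y → ball p (n + 1) z →
      ¬ ball p n z → ∃ w, close w y ∧ close w z ∧ ball p n w)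
    (quadrangle : ∀ p n y z t, close y t → close z t → ball p (n + 1) y → ¬ ball p n y →
      ball p (n + 1) z → ¬ ball p n z → ball p (n + 2) t → ¬ ball p (n + 1) t →
      ∃ w, close w y ∧ close w z ∧ ball p n w) :
    Γ.IsWeaklyModular := by
  have ball_mono : ∀ p n y, ball p n y → ball p (n + 1) y :=
    fun p n y h => ball_succ p n y y (close_refl y) h
  have walk_of_ball : ∀ p n y, ball p n y → ∃ q : Γ.Walk p y, q.length ≤ n := by
    intro p n
    induction n with
    | zero =>
      intro y h
      obtain rfl := (ball_zero p y).1 h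
      exact ⟨.nil, le_rfl⟩
    | succ n ih =>
      intro y h
      by_cases h' : ball p n y
      · obtain ⟨q, hq⟩ := ih y h'
        exact ⟨q, hq.trans n.le_succ⟩
      · obtain ⟨w, hwy, -, hw⟩ := triangle p n y y (close_refl y) h h' h h'
        obtain ⟨q, hq⟩ := ih w hw
        have hne : w ≠ y := by rintro rfl; exact h' hw
        exact ⟨q.concat ((adj_iff w y).2 ⟨hne, hwy⟩), by simpa using hq⟩
  have ball_of_walk : ∀ p n y (q : Γ.Walk y p), q.length = n → ball p n y := by
    intro p n
    induction n with
    | zero => exact fun y q hq => (ball_zero p y).2 (q.eq_of_length_eq_zero hq)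
    | succ n ih =>
      intro y q hq
      cases q with
      | nil => simp at hq
      | cons h q =>
        exact ball_succ p n _ _ ((adj_iff _ _).1 h.symm).2 (ih _ q (by simpa using hq))
  have conn : Γ.Connected :=
    ⟨fun p y => let ⟨n, h⟩ := exists_ball p y; (walk_of_ball p n y h).choose.reachable⟩
  have ball_mono' : ∀ p y m n, m ≤ n → ball p m y → ball p n y := by
    intro p y m n hmn h
    induction hmn with
    | refl => exact h
    | step _ ih => exact ball_mono _ _ _ ih
  have dist_le_iff : ∀ p y n, Γ.dist p y ≤ n ↔ ball p n y := by
    refine fun p y n => ⟨fun h => ?_, fun h => ?_⟩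
    · obtain ⟨q, hq⟩ := (conn p y).exists_walk_length_eq_dist
      exact ball_mono' _ _ _ _ h (ball_of_walk p _ y q.reverse (by simpa using hq))
    · obtain ⟨q, hq⟩ := walk_of_ball p n y h
      exact (SimpleGraph.dist_le q).trans hq
  have ball_of_dist : ∀ p y n, Γ.dist p y = n + 1 → ball p (n + 1) y ∧ ¬ ball p n y := by
    intro p y n h
    rw [← dist_le_iff, ← dist_le_iff]
    lia
  -- A point of the `n`-ball within one step of a point at distance `n + 1` is distinct from it and
  -- at distance exactly `n`.
  have conclude : ∀ p n y z w, Γ.dist p y = n + 1 → Γ.dist p z = n + 1 → close w y → close w z →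
      ball p n w → Γ.dist w p = n + 1 - 1 ∧ Γ.dist w y = 1 ∧ Γ.dist w z = 1 := by
    intro p n y z w hy hz hwy hwz hw
    have hw' := (dist_le_iff _ _ _).2 hw
    have hy1 : Γ.dist w y = 1 := SimpleGraph.dist_eq_one_iff_adj.2
      ((adj_iff _ _).2 ⟨by rintro rfl; lia, hwy⟩)
    have hz1 : Γ.dist w z = 1 := SimpleGraph.dist_eq_one_iff_adj.2
      ((adj_iff _ _).2 ⟨by rintro rfl; lia, hwz⟩)
    have := conn.dist_triangle (u := p) (v := w) (w := y)
    rw [SimpleGraph.dist_comm (u := w) (v := p)]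
    exact ⟨by lia, hy1, hz1⟩
  refine ⟨conn, fun p n hn y z hyz hy hz => ?_, fun p n hn y z hy hz _ ⟨t, hyt, hzt, ht⟩ => ?_⟩
  · obtain ⟨n, rfl⟩ : ∃ m, n = m + 1 := ⟨n - 1, by lia⟩
    obtain ⟨w, hwy, hwz, hw⟩ := triangle p n y z ((adj_iff _ _).1 hyz).2 (ball_of_dist _ _ _ hy).1
      (ball_of_dist _ _ _ hy).2 (ball_of_dist _ _ _ hz).1 (ball_of_dist _ _ _ hz).2
    exact ⟨w, conclude p n y z w hy hz hwy hwz hw⟩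
  · obtain ⟨n, rfl⟩ : ∃ m, n = m + 1 := ⟨n - 1, by lia⟩
    obtain ⟨w, hwy, hwz, hw⟩ := quadrangle p n y z t ((adj_iff _ _).1 hyt).2
      ((adj_iff _ _).1 hzt).2 (ball_of_dist _ _ _ hy).1
      (ball_of_dist _ _ _ hy).2 (ball_of_dist _ _ _ hz).1 (ball_of_dist _ _ _ hz).2
      (ball_of_dist _ _ _ ht).1 (ball_of_dist _ _ _ ht).2
    exact ⟨w, conclude p n y z w hy hz hwy hwz hw⟩

theorem Equiv.Perm.zpow_apply_zpow_apply {α : Type*} (τ : Equiv.Perm α) (j k : ℤ) (x : α) :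
    (τ ^ j) ((τ ^ k) x) = (τ ^ (j + k)) x := by
  rw [zpow_add, Equiv.Perm.mul_apply]

theorem Equiv.Perm.apply_zpow_apply {α : Type*} (τ : Equiv.Perm α) (k : ℤ) (x : α) :
    τ ((τ ^ k) x) = (τ ^ (k + 1)) x := by
  rw [add_comm, zpow_add, zpow_one, Equiv.Perm.mul_apply]

theorem Equiv.Perm.zpow_apply_apply {α : Type*} (τ : Equiv.Perm α) (k : ℤ) (x : α) :
    (τ ^ k) (τ x) = (τ ^ (k + 1)) x := by
  rw [zpow_add, zpow_one, Equiv.Perm.mul_apply]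

/-! ### Order automorphisms of a lattice with cofinal iterates -/

/-- A permutation of a lattice that preserves and reflects the order, moves every element up, and
whose positive iterates of any element are cofinal. -/
structure IsGarsideShift {L : Type*} [Lattice L] (τ : Equiv.Perm L) : Prop where
  apply_le_apply : ∀ x y, τ x ≤ τ y ↔ x ≤ y
  le_apply : ∀ x, x ≤ τ x
  cofinal : ∀ x y, ∃ n : ℕ, x ≤ (τ ^ n) y

namespace IsGarsideShift

variable {L : Type*} [Lattice L] {τ : Equiv.Perm L} (hτ : IsGarsideShift τ)
include hτ

theorem pow_le_pow (n : ℕ) (x y : L) : (τ ^ n) x ≤ (τ ^ n) y ↔ x ≤ y := by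
  induction n with
  | zero => simp
  | succ n ih => rw [pow_succ', Equiv.Perm.mul_apply, Equiv.Perm.mul_apply, hτ.apply_le_apply, ih]

theorem zpow_le_zpow (k : ℤ) (x y : L) : (τ ^ k) x ≤ (τ ^ k) y ↔ x ≤ y := by
  obtain ⟨n, rfl | rfl⟩ := k.eq_nat_or_neg
  · exact hτ.pow_le_pow n x y
  · rw [← hτ.pow_le_pow n]
    simp only [← zpow_natCast, τ.zpow_apply_zpow_apply, add_neg_cancel, zpow_zero, Equiv.Perm.one_apply]

theorem zpow_le_iff (k : ℤ) (x y : L) : (τ ^ k) x ≤ y ↔ x ≤ (τ ^ (-k)) y := by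
  rw [← hτ.zpow_le_zpow (-k), τ.zpow_apply_zpow_apply, neg_add_cancel, zpow_zero, Equiv.Perm.one_apply]

theorem le_zpow_iff (k : ℤ) (x y : L) : x ≤ (τ ^ k) y ↔ (τ ^ (-k)) x ≤ y := by
  rw [hτ.zpow_le_iff, neg_neg]

theorem le_pow (n : ℕ) (x : L) : x ≤ (τ ^ n) x := by
  induction n with
  | zero => exact le_rfl
  | succ n ih =>
    rw [pow_succ', Equiv.Perm.mul_apply]
    exact ih.trans (hτ.le_apply _)

theorem zpow_mono {j k : ℤ} (h : j ≤ k) (x : L) : (τ ^ j) x ≤ (τ ^ k) x := by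
  obtain ⟨n, rfl⟩ := Int.le.dest h
  rw [← τ.zpow_apply_zpow_apply, hτ.zpow_le_zpow]
  exact hτ.le_pow n x

theorem le_zpow {k : ℤ} (h : 0 ≤ k) (x : L) : x ≤ (τ ^ k) x := by
  simpa using hτ.zpow_mono h x

theorem zpow_le {k : ℤ} (h : k ≤ 0) (x : L) : (τ ^ k) x ≤ x := by
  simpa using hτ.zpow_mono h x

theorem zpow_inf (k : ℤ) (x y : L) : (τ ^ k) (x ⊓ y) = (τ ^ k) x ⊓ (τ ^ k) y := by
  refine le_antisymm (le_inf ?_ ?_) ?_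
  · exact (hτ.zpow_le_zpow _ _ _).2 inf_le_left
  · exact (hτ.zpow_le_zpow _ _ _).2 inf_le_right
  · rw [hτ.le_zpow_iff]
    exact le_inf ((hτ.zpow_le_iff _ _ _).2 (by simp)) ((hτ.zpow_le_iff _ _ _).2 (by simp))

theorem apply_inf (x y : L) : τ (x ⊓ y) = τ x ⊓ τ y := by
  simpa using hτ.zpow_inf 1 x y

theorem zpow_sup (k : ℤ) (x y : L) : (τ ^ k) (x ⊔ y) = (τ ^ k) x ⊔ (τ ^ k) y := by
  refine le_antisymm ?_ (sup_le ?_ ?_)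
  · rw [hτ.zpow_le_iff]
    exact sup_le ((hτ.zpow_le_iff _ _ _).1 le_sup_left) ((hτ.zpow_le_iff _ _ _).1 le_sup_right)
  · exact (hτ.zpow_le_zpow _ _ _).2 le_sup_left
  · exact (hτ.zpow_le_zpow _ _ _).2 le_sup_right

theorem apply_sup (x y : L) : τ (x ⊔ y) = τ x ⊔ τ y := by
  simpa using hτ.zpow_sup 1 x y

theorem le_zpow_of_le {x y : L} {j k : ℤ} (h : y ≤ (τ ^ j) x) (hjk : j ≤ k) : y ≤ (τ ^ k) x :=
  h.trans (hτ.zpow_mono hjk x)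

theorem zpow_le_of_le {x y : L} {j k : ℤ} (h : (τ ^ j) x ≤ y) (hjk : k ≤ j) : (τ ^ k) x ≤ y :=
  (hτ.zpow_mono hjk x).trans h

theorem le_apply_zpow_of_le {x y : L} {j k : ℤ} (h : y ≤ (τ ^ j) x) (hjk : j ≤ k + 1) :
    y ≤ τ ((τ ^ k) x) := by
  rw [τ.apply_zpow_apply]
  exact hτ.le_zpow_of_le h hjk

theorem zpow_le_apply_of_le {x y : L} {j k : ℤ} (h : (τ ^ j) x ≤ y) (hjk : k ≤ j + 1) :
    (τ ^ k) x ≤ τ y := by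
  refine hτ.zpow_le_of_le ?_ hjk
  rw [← τ.apply_zpow_apply]
  exact (hτ.apply_le_apply _ _).2 h

/-! ### The metric of the graph defined by a shift -/

/-- The reflexive closure of the adjacency relation defined by `τ`. -/
def Close (_ : IsGarsideShift τ) (y z : L) : Prop :=
  (y ≤ z ∧ z ≤ τ y) ∨ (z ≤ y ∧ y ≤ τ z)

/-- The least `n` with `y ≤ τ ^ n p`. -/
noncomputable def up (_ : IsGarsideShift τ) (p y : L) : ℕ := sInf {n : ℕ | y ≤ (τ ^ (n : ℤ)) p}

theorem up_le_iff (p y : L) (n : ℕ) : hτ.up p y ≤ n ↔ y ≤ (τ ^ (n : ℤ)) p := by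
  -- Cofinality makes the set nonempty, so `sInf` is a true minimum and not the default value 0.
  have hne : {n : ℕ | y ≤ (τ ^ (n : ℤ)) p}.Nonempty := by
    obtain ⟨n, hn⟩ := hτ.cofinal y p
    exact ⟨n, by simpa using hn⟩
  refine ⟨fun h => ?_, fun h => Nat.sInf_le h⟩
  exact hτ.le_zpow_of_le (Nat.sInf_mem hne) (by exact_mod_cast h)

theorem up_le_iff' (p y : L) (n : ℕ) : hτ.up y p ≤ n ↔ (τ ^ (-n : ℤ)) p ≤ y := by
  rw [up_le_iff, hτ.zpow_le_iff, neg_neg]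

theorem eq_of_up_add_up_eq_zero {p y : L} (h : hτ.up p y + hτ.up y p = 0) : y = p :=
  le_antisymm (by simpa using (hτ.up_le_iff p y 0).1 (by lia))
    (by simpa using (hτ.up_le_iff y p 0).1 (by lia))

theorem up_self (p : L) : hτ.up p p = 0 :=
  Nat.le_zero.1 ((hτ.up_le_iff p p 0).2 (by simp))

theorem le_up (p y : L) : y ≤ (τ ^ (hτ.up p y : ℤ)) p :=
  (hτ.up_le_iff p y _).1 le_rfl

theorem up_le (p y : L) : (τ ^ (-hτ.up y p : ℤ)) p ≤ y :=
  (hτ.up_le_iff' p y _).1 le_rfl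

/-- Along an edge `y ≤ z ≤ τ y` the upper exponent rises by 0 or 1 and the lower exponent falls by 0
or 1. This and the next three bounds drive all the case distinctions below. -/
theorem up_mono_right (p : L) {y z : L} (h : y ≤ z) : hτ.up p y ≤ hτ.up p z :=
  (hτ.up_le_iff _ _ _).2 (h.trans (hτ.le_up p z))

theorem up_anti_left (p : L) {y z : L} (h : y ≤ z) : hτ.up z p ≤ hτ.up y p :=
  (hτ.up_le_iff' _ _ _).2 ((hτ.up_le p y).trans h)

theorem up_le_succ_right (p : L) {y z : L} (h : z ≤ τ y) : hτ.up p z ≤ hτ.up p y + 1 := by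
  rw [up_le_iff, Nat.cast_succ, ← τ.apply_zpow_apply]
  exact h.trans ((hτ.apply_le_apply _ _).2 (hτ.le_up p y))

theorem up_le_succ_left (p : L) {y z : L} (h : z ≤ τ y) : hτ.up y p ≤ hτ.up z p + 1 := by
  rw [up_le_iff, Nat.cast_succ, ← τ.zpow_apply_apply]
  exact (hτ.le_up z p).trans ((hτ.zpow_le_zpow _ _ _).2 h)

/-- The quantity `hτ.up p y + hτ.up y p`, which turns out to be the distance from `p` to `y`. -/
noncomputable def gap (p y : L) : ℕ := hτ.up p y + hτ.up y p

/-- Any exponents that work bound the least ones, so an explicit witness needs only two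
inequalities. -/
theorem gap_le {p y : L} {n : ℕ} (a b : ℕ) (hab : a + b ≤ n) (ha : y ≤ (τ ^ (a : ℤ)) p)
    (hb : (τ ^ (-b : ℤ)) p ≤ y) : hτ.gap p y ≤ n :=
  (add_le_add ((hτ.up_le_iff _ _ _).2 ha) ((hτ.up_le_iff' _ _ _).2 hb)).trans hab

theorem gap_le_succ_of_close (p : L) {y z : L} (h : hτ.Close y z) :
    hτ.gap p z ≤ hτ.gap p y + 1 := by
  unfold gap
  rcases h with ⟨h, h'⟩ | ⟨h, h'⟩
  · have := hτ.up_le_succ_right p h'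
    have := hτ.up_anti_left p h
    lia
  · have := hτ.up_le_succ_left p h'
    have := hτ.up_mono_right p h
    lia

theorem gap_triangle_of_le {p y z : L} {n : ℕ} (hyz : y ≤ z) (hzy : z ≤ τ y)
    (hy : hτ.gap p y = n + 1) (hz : hτ.gap p z = n + 1) :
    ∃ w, hτ.Close w y ∧ hτ.Close w z ∧ hτ.gap p w ≤ n := by
  have a1 := hτ.up_mono_right p hyz
  have b1 := hτ.up_anti_left p hyz
  have a2 := hτ.up_le_succ_right p hzy
  have b2 := hτ.up_le_succ_left p hzy
  have Y1 := hτ.le_up p y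
  have Y2 := hτ.up_le p y
  have Z1 := hτ.le_up p z
  have Z2 := hτ.up_le p z
  unfold gap at hy hz
  generalize hτ.up p y = a at *
  generalize hτ.up p z = a' at *
  generalize hτ.up y p = b at *
  generalize hτ.up z p = b' at *
  obtain rfl | rfl : a' = a ∨ a' = a + 1 := by lia
  · obtain rfl : b' = b := by lia
    -- Both exponents agree here. The upper one is lowered by a meet unless it is 0; then the lower
    -- one is positive, because the sum is `n + 1`, and is reduced by a join.
    rcases a' with _ | a
    · obtain ⟨b, rfl⟩ : ∃ c, b' = c + 1 := ⟨b' - 1, by lia⟩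
      have hw : z ⊔ (τ ^ (-b : ℤ)) p ≤ τ y :=
        sup_le hzy (hτ.zpow_le_apply_of_le Y2 (by lia))
      refine ⟨z ⊔ (τ ^ (-b : ℤ)) p, .inr ⟨hyz.trans le_sup_left, hw⟩,
        .inr ⟨le_sup_left, hw.trans ((hτ.apply_le_apply _ _).2 hyz)⟩, ?_⟩
      exact hτ.gap_le 0 b (by lia) (sup_le Z1 (hτ.zpow_mono (by lia) p)) le_sup_right
    · have hw : z ≤ τ (y ⊓ (τ ^ (a : ℤ)) p) := by
        rw [hτ.apply_inf]
        exact le_inf hzy (hτ.le_apply_zpow_of_le Z1 (by lia))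
      refine ⟨y ⊓ (τ ^ (a : ℤ)) p, .inl ⟨inf_le_left, hyz.trans hw⟩,
        .inl ⟨inf_le_left.trans hyz, hw⟩, ?_⟩
      exact hτ.gap_le a b' (by lia) inf_le_right (le_inf Y2 (hτ.zpow_mono (by lia) p))
  · obtain rfl : b = b' + 1 := by lia
    -- Here `y` has the smaller upper exponent and `z` the smaller lower one. The join keeps the
    -- former and attains the latter, and their sum is `n`.
    have hw : y ⊔ (τ ^ (-b' : ℤ)) p ≤ z := sup_le hyz Z2
    refine ⟨y ⊔ (τ ^ (-b' : ℤ)) p, .inr ⟨le_sup_left, hw.trans hzy⟩,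
      .inl ⟨hw, hzy.trans ((hτ.apply_le_apply _ _).2 le_sup_left)⟩, ?_⟩
    exact hτ.gap_le a b' (by lia) (sup_le Y1 (hτ.zpow_mono (by lia) p)) le_sup_right

theorem gap_triangle {p y z : L} {n : ℕ} (h : hτ.Close y z)
    (hy : hτ.gap p y = n + 1) (hz : hτ.gap p z = n + 1) :
    ∃ w, hτ.Close w y ∧ hτ.Close w z ∧ hτ.gap p w ≤ n := by
  rcases h with ⟨h, h'⟩ | ⟨h, h'⟩
  · exact hτ.gap_triangle_of_le h h' hy hz
  · obtain ⟨w, hz, hy, hw⟩ := hτ.gap_triangle_of_le h h' hz hy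
    exact ⟨w, hy, hz, hw⟩

/-- Going up to `t` costs one step, so the upper exponent of `t` exceeds those of `y` and `z` by
exactly one. Thus `y` and `z` share both exponents, and the common bound `t` keeps their meet and
join within one shift of each. -/
theorem gap_quadrangle_of_le_of_le {p y z t : L} {n : ℕ} (hyt : y ≤ t) (hty : t ≤ τ y)
    (hzt : z ≤ t) (htz : t ≤ τ z) (hy : hτ.gap p y = n + 1) (hz : hτ.gap p z = n + 1)
    (ht : hτ.gap p t = n + 2) :
    ∃ w, hτ.Close w y ∧ hτ.Close w z ∧ hτ.gap p w ≤ n := by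
  have a1 := hτ.up_mono_right p hyt
  have b1 := hτ.up_anti_left p hyt
  have a2 := hτ.up_le_succ_right p hty
  have a3 := hτ.up_mono_right p hzt
  have b3 := hτ.up_anti_left p hzt
  have a4 := hτ.up_le_succ_right p htz
  have Y1 := hτ.le_up p y
  have Y2 := hτ.up_le p y
  have Z1 := hτ.le_up p z
  have Z2 := hτ.up_le p z
  have T1 := hτ.le_up p t
  unfold gap at hy hz ht
  generalize hτ.up p y = a at *
  generalize hτ.up p z = a' at *
  generalize hτ.up y p = b at *
  generalize hτ.up z p = b' at *
  generalize hτ.up p t = c at *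
  obtain rfl : a' = a := by lia
  obtain rfl : b' = b := by lia
  obtain rfl : c = a' + 1 := by lia
  rcases a' with _ | a
  · obtain ⟨b, rfl⟩ : ∃ c, b' = c + 1 := ⟨b' - 1, by lia⟩
    refine ⟨y ⊔ z ⊔ (τ ^ (-b : ℤ)) p, .inr ⟨le_sup_left.trans' le_sup_left, ?_⟩,
      .inr ⟨le_sup_left.trans' le_sup_right, ?_⟩, ?_⟩
    · exact sup_le ((sup_le hyt hzt).trans hty) (hτ.zpow_le_apply_of_le Y2 (by lia))
    · exact sup_le ((sup_le hyt hzt).trans htz) (hτ.zpow_le_apply_of_le Z2 (by lia))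
    · exact hτ.gap_le 0 b (by lia) (sup_le (sup_le Y1 Z1) (hτ.zpow_mono (by lia) p)) le_sup_right
  · have hw : ∀ u, u ≤ t → u ≤ (τ ^ ((a + 1 : ℕ) : ℤ)) p → u ≤ τ (y ⊓ z ⊓ (τ ^ (a : ℤ)) p) := by
      intro u hut hup
      rw [hτ.apply_inf, hτ.apply_inf]
      exact le_inf (hut.trans (le_inf hty htz)) (hτ.le_apply_zpow_of_le hup (by lia))
    refine ⟨y ⊓ z ⊓ (τ ^ (a : ℤ)) p, .inl ⟨inf_le_left.trans inf_le_left, hw y hyt Y1⟩,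
      .inl ⟨inf_le_left.trans inf_le_right, hw z hzt Z1⟩, ?_⟩
    exact hτ.gap_le a b' (by lia) inf_le_right (le_inf (le_inf Y2 Z2) (hτ.zpow_mono (by lia) p))

theorem gap_quadrangle_of_ge_of_ge {p y z t : L} {n : ℕ} (hty : t ≤ y) (hyt : y ≤ τ t)
    (htz : t ≤ z) (hzt : z ≤ τ t) (hy : hτ.gap p y = n + 1) (hz : hτ.gap p z = n + 1)
    (ht : hτ.gap p t = n + 2) :
    ∃ w, hτ.Close w y ∧ hτ.Close w z ∧ hτ.gap p w ≤ n := by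
  have a1 := hτ.up_mono_right p hty
  have b1 := hτ.up_anti_left p hty
  have b2 := hτ.up_le_succ_left p hyt
  have a3 := hτ.up_mono_right p htz
  have b3 := hτ.up_anti_left p htz
  have b4 := hτ.up_le_succ_left p hzt
  have Y1 := hτ.le_up p y
  have Y2 := hτ.up_le p y
  have Z1 := hτ.le_up p z
  have Z2 := hτ.up_le p z
  unfold gap at hy hz ht
  generalize hτ.up p y = a at *
  generalize hτ.up p z = a' at *
  generalize hτ.up y p = b at *
  generalize hτ.up z p = b' at *
  generalize hτ.up p t = c at *
  obtain rfl : a' = a := by lia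
  obtain rfl : b' = b := by lia
  have hyz : y ≤ τ z := hyt.trans ((hτ.apply_le_apply _ _).2 htz)
  have hzy : z ≤ τ y := hzt.trans ((hτ.apply_le_apply _ _).2 hty)
  rcases b' with _ | b
  · obtain ⟨a, rfl⟩ : ∃ c, a' = c + 1 := ⟨a' - 1, by lia⟩
    have hw : ∀ u, u ≤ τ t → u ≤ (τ ^ ((a + 1 : ℕ) : ℤ)) p →
        u ≤ τ (y ⊓ z ⊓ (τ ^ (a : ℤ)) p) := by
      intro u hut hup
      rw [hτ.apply_inf]
      exact le_inf (hut.trans ((hτ.apply_le_apply _ _).2 (le_inf hty htz)))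
        (hτ.le_apply_zpow_of_le hup (by lia))
    refine ⟨y ⊓ z ⊓ (τ ^ (a : ℤ)) p, .inl ⟨inf_le_left.trans inf_le_left, hw y hyt Y1⟩,
      .inl ⟨inf_le_left.trans inf_le_right, hw z hzt Z1⟩, ?_⟩
    exact hτ.gap_le a 0 (by lia) inf_le_right (le_inf (le_inf Y2 Z2) (hτ.zpow_mono (by lia) p))
  · refine ⟨y ⊔ z ⊔ (τ ^ (-b : ℤ)) p, .inr ⟨le_sup_left.trans' le_sup_left, ?_⟩,
      .inr ⟨le_sup_left.trans' le_sup_right, ?_⟩, ?_⟩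
    · exact sup_le (sup_le (hτ.le_apply y) hzy) (hτ.zpow_le_apply_of_le Y2 (by lia))
    · exact sup_le (sup_le hyz (hτ.le_apply z)) (hτ.zpow_le_apply_of_le Z2 (by lia))
    · exact hτ.gap_le a' b (by lia) (sup_le (sup_le Y1 Z1) (hτ.zpow_mono (by lia) p)) le_sup_right

/-- The step from `y` to `t` raises the upper exponent and the step from `t` to `z` reduces the
lower one, so `y` has the smaller upper exponent and `z` the smaller lower one. -/
theorem gap_quadrangle_of_le_of_ge {p y z t : L} {n : ℕ} (hyt : y ≤ t) (hty : t ≤ τ y)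
    (htz : t ≤ z) (hzt : z ≤ τ t) (hy : hτ.gap p y = n + 1) (hz : hτ.gap p z = n + 1)
    (ht : hτ.gap p t = n + 2) :
    ∃ w, hτ.Close w y ∧ hτ.Close w z ∧ hτ.gap p w ≤ n := by
  have a1 := hτ.up_le_succ_right p hty
  have b1 := hτ.up_anti_left p hyt
  have a2 := hτ.up_mono_right p htz
  have b2 := hτ.up_le_succ_left p hzt
  have Y1 := hτ.le_up p y
  have Z1 := hτ.le_up p z
  have Y2 := hτ.up_le p y
  have Z2 := hτ.up_le p z
  unfold gap at hy hz ht
  generalize hτ.up p y = a at *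
  generalize hτ.up p z = a' at *
  generalize hτ.up y p = b at *
  generalize hτ.up z p = b' at *
  generalize hτ.up p t = c at *
  obtain rfl : a' = a + 1 := by lia
  obtain rfl : b = b' + 1 := by lia
  -- Joining `τ⁻¹ z` to the witness forces `z ≤ τ w`; it is harmless since `τ⁻¹ z ≤ t ≤ τ y` and
  -- `τ⁻¹ z ≤ τ ^ a p`.
  have hz' : (τ ^ (-1 : ℤ)) z ≤ t := (hτ.zpow_le_iff _ _ _).2 (by simpa using hzt)
  have hw : z ≤ τ (y ⊔ (τ ^ (-b' : ℤ)) p ⊔ (τ ^ (-1 : ℤ)) z) := by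
    rw [hτ.apply_sup, τ.apply_zpow_apply]
    simp
  refine ⟨y ⊔ (τ ^ (-b' : ℤ)) p ⊔ (τ ^ (-1 : ℤ)) z, .inr ⟨le_sup_left.trans' le_sup_left, ?_⟩,
    .inl ⟨sup_le (sup_le (hyt.trans htz) Z2) (hz'.trans htz), hw⟩, ?_⟩
  · exact sup_le (sup_le (hτ.le_apply y) (hτ.zpow_le_apply_of_le Y2 (by lia))) (hz'.trans hty)
  · refine hτ.gap_le a b' (by lia) (sup_le (sup_le Y1 (hτ.zpow_mono (by lia) p)) ?_)
      (le_sup_left.trans' le_sup_right)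
    rw [hτ.zpow_le_iff, τ.zpow_apply_zpow_apply]
    exact hτ.le_zpow_of_le Z1 (by lia)

theorem gap_quadrangle {p y z t : L} {n : ℕ} (hyt : hτ.Close y t) (hzt : hτ.Close z t)
    (hy : hτ.gap p y = n + 1) (hz : hτ.gap p z = n + 1) (ht : hτ.gap p t = n + 2) :
    ∃ w, hτ.Close w y ∧ hτ.Close w z ∧ hτ.gap p w ≤ n := by
  rcases hyt with ⟨h1, h2⟩ | ⟨h1, h2⟩ <;> rcases hzt with ⟨h3, h4⟩ | ⟨h3, h4⟩
  · exact hτ.gap_quadrangle_of_le_of_le h1 h2 h3 h4 hy hz ht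
  · exact hτ.gap_quadrangle_of_le_of_ge h1 h2 h3 h4 hy hz ht
  · obtain ⟨w, hz, hy, hw⟩ := hτ.gap_quadrangle_of_le_of_ge h3 h4 h1 h2 hz hy ht
    exact ⟨w, hy, hz, hw⟩
  · exact hτ.gap_quadrangle_of_ge_of_ge h1 h2 h3 h4 hy hz ht

/-- The graph with edges `y ≤ z ≤ τ y` is weakly modular. -/
theorem isWeaklyModular [Nonempty L] (Γ : SimpleGraph L)
    (adj_iff : ∀ y z, Γ.Adj y z ↔ y ≠ z ∧ hτ.Close y z) : Γ.IsWeaklyModular := by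
  refine Γ.isWeaklyModular_of_ball hτ.Close (fun p n y => hτ.gap p y ≤ n) adj_iff
    (fun y => .inl ⟨le_rfl, hτ.le_apply y⟩) (fun p y => ?_) (fun p n y z h hy => ?_)
    (fun p y => ⟨_, le_rfl⟩) (fun p n y z h hy hy' hz hz' => ?_)
    (fun p n y z t hyt hzt hy hy' hz hz' ht ht' => ?_)
  · constructor
    · exact fun h => hτ.eq_of_up_add_up_eq_zero (Nat.le_zero.1 h)
    · rintro rfl
      simp [gap, up_self]
  · exact (hτ.gap_le_succ_of_close p h).trans (by lia)
  · exact hτ.gap_triangle h (by lia) (by lia)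
  · exact hτ.gap_quadrangle hyt hzt (by lia) (by lia) (by lia)

end IsGarsideShift

/-! ### The quotient by the shift -/

namespace IsGarsideShift

variable {L : Type*} [Lattice L] {τ : Equiv.Perm L} (hτ : IsGarsideShift τ)

/-- The quotient of `L` by the cyclic group generated by `τ`. -/
abbrev Orbits (τ : Equiv.Perm L) : Type _ :=
  MulAction.orbitRel.Quotient (Subgroup.zpowers τ) L

/-- The orbit of an element. -/
def orbit (τ : Equiv.Perm L) (x : L) : Orbits τ := Quotient.mk _ x

omit [Lattice L] in
theorem orbit_eq_iff {x y : L} : orbit τ x = orbit τ y ↔ ∃ k : ℤ, (τ ^ k) y = x := by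
  rw [orbit, orbit, Quotient.eq, MulAction.orbitRel_apply, MulAction.mem_orbit_iff]
  constructor
  · rintro ⟨⟨_, k, rfl⟩, h⟩
    exact ⟨k, h⟩
  · rintro ⟨k, h⟩
    exact ⟨⟨_, k, rfl⟩, h⟩

omit [Lattice L] in
theorem orbit_zpow (k : ℤ) (x : L) : orbit τ ((τ ^ k) x) = orbit τ x :=
  orbit_eq_iff.2 ⟨k, rfl⟩

/-- Two orbits are close if they have representatives `y ≤ z ≤ τ y`. -/
def OrbitClose (τ : Equiv.Perm L) (Y Z : Orbits τ) : Prop :=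
  ∃ y z, orbit τ y = Y ∧ orbit τ z = Z ∧ y ≤ z ∧ z ≤ τ y

/-- The ball of radius `n` about the orbit of `p` consists of the orbits that meet the interval from
`p` to `τ ^ n p`. -/
def OrbitBall (τ : Equiv.Perm L) (P : Orbits τ) (n : ℕ) (Y : Orbits τ) : Prop :=
  ∃ p y, orbit τ p = P ∧ orbit τ y = Y ∧ p ≤ y ∧ y ≤ (τ ^ (n : ℤ)) p

include hτ

/-- Replacing `y` by `τ y` turns `y ≤ z ≤ τ y` into `z ≤ τ y ≤ τ z`, so a one-sided definition
suffices. -/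
theorem orbitClose_symm {Y Z : Orbits τ} (h : OrbitClose τ Y Z) : OrbitClose τ Z Y := by
  obtain ⟨y, z, hy, hz, hyz, hzy⟩ := h
  exact ⟨z, τ y, hz, by simpa using (orbit_zpow 1 y).trans hy, hzy, (hτ.apply_le_apply _ _).2 hyz⟩

theorem exists_of_orbitClose {y : L} {Z : Orbits τ} (h : OrbitClose τ (orbit τ y) Z) :
    ∃ z, orbit τ z = Z ∧ y ≤ z ∧ z ≤ τ y := by
  obtain ⟨y', z, hy, hz, hyz, hzy⟩ := h
  obtain ⟨k, rfl⟩ := orbit_eq_iff.1 hy.symm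
  refine ⟨(τ ^ k) z, (orbit_zpow k z).trans hz, (hτ.zpow_le_zpow _ _ _).2 hyz, ?_⟩
  rw [τ.apply_zpow_apply, ← τ.zpow_apply_apply]
  exact (hτ.zpow_le_zpow _ _ _).2 hzy

theorem exists_of_orbitBall {p : L} {n : ℕ} {Y : Orbits τ} (h : OrbitBall τ (orbit τ p) n Y) :
    ∃ y, orbit τ y = Y ∧ p ≤ y ∧ y ≤ (τ ^ (n : ℤ)) p := by
  obtain ⟨p', y, hp, hy, hpy, hyp⟩ := h
  obtain ⟨k, rfl⟩ := orbit_eq_iff.1 hp.symm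
  refine ⟨(τ ^ k) y, (orbit_zpow k y).trans hy, (hτ.zpow_le_zpow _ _ _).2 hpy, ?_⟩
  rw [τ.zpow_apply_zpow_apply, add_comm, ← τ.zpow_apply_zpow_apply]
  exact (hτ.zpow_le_zpow _ _ _).2 hyp

theorem orbit_triangle_of_le {p y z : L} {n : ℕ} (hpy : p ≤ y) (hyz : y ≤ z) (hzy : z ≤ τ y)
    (hz : z ≤ (τ ^ ((n + 1 : ℕ) : ℤ)) p) :
    ∃ W, OrbitClose τ W (orbit τ y) ∧ OrbitClose τ W (orbit τ z) ∧ OrbitBall τ (orbit τ p) n W := by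
  have hw : z ≤ τ (y ⊓ (τ ^ (n : ℤ)) p) := by
    rw [hτ.apply_inf]
    exact le_inf hzy (hτ.le_apply_zpow_of_le hz (by lia))
  exact ⟨_, ⟨_, y, rfl, rfl, inf_le_left, hyz.trans hw⟩,
    ⟨_, z, rfl, rfl, inf_le_left.trans hyz, hw⟩,
    ⟨p, _, rfl, rfl, le_inf hpy (hτ.le_zpow (by lia) p), inf_le_right⟩⟩

theorem orbit_triangle {P Y Z : Orbits τ} {n : ℕ} (h : OrbitClose τ Y Z)
    (hY : OrbitBall τ P (n + 1) Y) (hZ : OrbitBall τ P (n + 1) Z) :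
    ∃ W, OrbitClose τ W Y ∧ OrbitClose τ W Z ∧ OrbitBall τ P n W := by
  obtain ⟨p, y, rfl, rfl, hpy, hyp⟩ := hY
  obtain ⟨z, rfl, hpz, hzp⟩ := hτ.exists_of_orbitBall hZ
  obtain ⟨_, hk, hyz, hzy⟩ := hτ.exists_of_orbitClose h
  obtain ⟨k, rfl⟩ := orbit_eq_iff.1 hk
  -- The upper member of the close pair must stay below `τ ^ (n + 1) p`. For `k ≤ 0` the pair `y ≤ τ
  -- ^ k z` does. Otherwise `y ≤ τ ^ k z ≤ τ y` is rewritten as `z ≤ τ ^ (1 - k) y ≤ τ z`, with `1 -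
  -- k ≤ 0`.
  rcases le_or_gt k 0 with hk0 | hk0
  · rw [← hk]
    exact hτ.orbit_triangle_of_le hpy hyz hzy ((hτ.zpow_le hk0 z).trans hzp)
  · have h1 : z ≤ (τ ^ (1 - k)) y := by
      rw [← hτ.zpow_le_zpow k, τ.zpow_apply_zpow_apply]
      simpa using hzy
    have h2 : (τ ^ (1 - k)) y ≤ τ z := by
      rw [hτ.zpow_le_iff, τ.zpow_apply_apply]
      simpa using hyz
    obtain ⟨W, hWz, hWy, hW⟩ := hτ.orbit_triangle_of_le hpz h1 h2
      ((hτ.zpow_le (by lia) y).trans hyp)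
    exact ⟨W, by rwa [orbit_zpow] at hWy, hWz, hW⟩

/-- If all `τ ^ j p` have a common upper bound, then there is only one orbit. -/
theorem orbit_eq_of_forall_zpow_le {p t : L} (h : ∀ j : ℕ, p ≤ (τ ^ (-j : ℤ)) t) :
    orbit τ t = orbit τ p := by
  obtain ⟨m, hm⟩ := hτ.cofinal t p
  refine orbit_eq_iff.2 ⟨m, le_antisymm ?_ (by simpa using hm)⟩
  rw [hτ.zpow_le_iff]
  exact h m

/-- An orbit in the ball of radius `n` other than the centre has a representative that lies as low
as possible above `p`. -/
theorem exists_not_le_of_orbitBall {p : L} {n : ℕ} {T : Orbits τ} (hT : T ≠ orbit τ p)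
    (h : OrbitBall τ (orbit τ p) n T) :
    ∃ t, orbit τ t = T ∧ p ≤ t ∧ t ≤ (τ ^ (n : ℤ)) p ∧ ¬ p ≤ (τ ^ (-1 : ℤ)) t := by
  classical
  obtain ⟨t, rfl, hpt, htp⟩ := hτ.exists_of_orbitBall h
  have hex : ∃ j : ℕ, ¬ p ≤ (τ ^ (-j : ℤ)) t := by
    by_contra! hall
    exact hT (hτ.orbit_eq_of_forall_zpow_le hall)
  -- The least failing exponent is positive as `p ≤ t`; its predecessor `j` gives the lowest
  -- translate still above `p`.
  obtain ⟨j, hj⟩ : ∃ j, Nat.find hex = j + 1 := by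
    refine Nat.exists_eq_succ_of_ne_zero fun h0 => ?_
    have := Nat.find_spec hex
    rw [h0] at this
    exact this (by simpa using hpt)
  refine ⟨(τ ^ (-j : ℤ)) t, orbit_zpow _ _, not_not.1 (Nat.find_min hex (m := j) (by lia)),
    (hτ.zpow_le (by lia) t).trans htp, ?_⟩
  rw [τ.zpow_apply_zpow_apply]
  have := Nat.find_spec hex
  rw [hj] at this
  convert this using 4
  lia

/-- Closeness gives `y ≤ τ ^ k t ≤ τ y`. If `k < 0`, then `p ≤ τ⁻¹ t`, against the low choice of
`t`; if `k > 0`, then `t ≤ y`, which puts `t` in the `n`-ball. So `k = 0`, and the quotient has only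
one quadrangle configuration. -/
theorem le_of_orbitClose {p t y : L} {n : ℕ} (hpt : p ≤ t) (ht : ¬ p ≤ (τ ^ (-1 : ℤ)) t)
    (hn : ¬ OrbitBall τ (orbit τ p) n (orbit τ t)) (hpy : p ≤ y) (hyp : y ≤ (τ ^ (n : ℤ)) p)
    (h : OrbitClose τ (orbit τ y) (orbit τ t)) : y ≤ t ∧ t ≤ τ y := by
  obtain ⟨_, hk, hyt, hty⟩ := hτ.exists_of_orbitClose h
  obtain ⟨k, rfl⟩ := orbit_eq_iff.1 hk
  obtain hk | rfl | hk : k ≤ -1 ∨ k = 0 ∨ 1 ≤ k := by lia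
  · exact absurd ((hpy.trans hyt).trans (hτ.zpow_mono hk t)) ht
  · simpa using ⟨hyt, hty⟩
  · refine absurd ⟨p, t, rfl, rfl, hpt, ((hτ.le_zpow (k := k - 1) (by lia) t).trans ?_).trans hyp⟩ hn
    rw [← hτ.apply_le_apply, τ.apply_zpow_apply]
    simpa using hty

theorem orbit_quadrangle {P Y Z T : Orbits τ} {n : ℕ} (hYT : OrbitClose τ Y T)
    (hZT : OrbitClose τ Z T) (hY : OrbitBall τ P (n + 1) Y) (hZ : OrbitBall τ P (n + 1) Z)
    (hT : OrbitBall τ P (n + 2) T) (hT' : ¬ OrbitBall τ P (n + 1) T) :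
    ∃ W, OrbitClose τ W Y ∧ OrbitClose τ W Z ∧ OrbitBall τ P n W := by
  obtain ⟨p, y, rfl, rfl, hpy, hyp⟩ := hY
  obtain ⟨z, rfl, hpz, hzp⟩ := hτ.exists_of_orbitBall hZ
  have hne : T ≠ orbit τ p := by
    rintro rfl
    exact hT' ⟨p, p, rfl, rfl, le_rfl, hτ.le_zpow (by lia) p⟩
  obtain ⟨t, rfl, hpt, htp, ht⟩ := hτ.exists_not_le_of_orbitBall hne hT
  obtain ⟨hyt, hty⟩ := hτ.le_of_orbitClose hpt ht hT' hpy hyp hYT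
  obtain ⟨hzt, htz⟩ := hτ.le_of_orbitClose hpt ht hT' hpz hzp hZT
  have hw : ∀ u, u ≤ t → u ≤ (τ ^ ((n + 1 : ℕ) : ℤ)) p → u ≤ τ (y ⊓ z ⊓ (τ ^ (n : ℤ)) p) := by
    intro u hut hup
    rw [hτ.apply_inf, hτ.apply_inf]
    exact le_inf (hut.trans (le_inf hty htz)) (hτ.le_apply_zpow_of_le hup (by lia))
  exact ⟨_, ⟨_, y, rfl, rfl, inf_le_left.trans inf_le_left, hw y hyt hyp⟩,
    ⟨_, z, rfl, rfl, inf_le_left.trans inf_le_right, hw z hzt hzp⟩,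
    ⟨p, _, rfl, rfl, le_inf (le_inf hpy hpz) (hτ.le_zpow (by lia) p), inf_le_right⟩⟩

/-- The quotient by `τ` of the graph with edges `y ≤ z ≤ τ y` is weakly modular. -/
theorem isWeaklyModular_orbitQuotient [Nonempty L] (Γ : SimpleGraph L)
    (adj_iff : ∀ y z, Γ.Adj y z ↔ y ≠ z ∧ hτ.Close y z) :
    (Γ.orbitQuotient (Subgroup.zpowers τ)).IsWeaklyModular := by
  have : Nonempty (Orbits τ) := ‹Nonempty L›.map (orbit τ)
  refine SimpleGraph.isWeaklyModular_of_ball _ (OrbitClose τ) (OrbitBall τ) (fun Y Z => ?_)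
    (fun Y => ?_) (fun P Y => ?_) (fun P n Y Z h hY => ?_) (fun P Y => ?_)
    (fun P n Y Z h hY _ hZ _ => hτ.orbit_triangle h hY hZ)
    (fun P n Y Z T hYT hZT hY _ hZ _ hT hT' => hτ.orbit_quadrangle hYT hZT hY hZ hT hT')
  · refine and_congr_right fun hne => ⟨?_, ?_⟩
    · rintro ⟨y, z, hy, hz, hyz⟩
      rcases ((adj_iff y z).1 hyz).2 with ⟨h, h'⟩ | ⟨h, h'⟩
      · exact ⟨y, z, hy, hz, h, h'⟩
      · exact hτ.orbitClose_symm ⟨z, y, hz, hy, h, h'⟩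
    · rintro ⟨y, z, hy, hz, h, h'⟩
      refine ⟨y, z, hy, hz, (adj_iff y z).2 ⟨?_, .inl ⟨h, h'⟩⟩⟩
      rintro rfl
      exact hne (hy.symm.trans hz)
  · obtain ⟨y, rfl⟩ := Quotient.exists_rep Y
    exact ⟨y, y, rfl, rfl, le_rfl, hτ.le_apply y⟩
  · constructor
    · rintro ⟨p, y, rfl, rfl, hpy, hyp⟩
      rw [le_antisymm hpy (by simpa using hyp)]
    · rintro rfl
      obtain ⟨p, rfl⟩ := Quotient.exists_rep Y
      exact ⟨p, p, rfl, rfl, le_rfl, by simp⟩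
  · obtain ⟨p, y, rfl, rfl, hpy, hyp⟩ := hY
    obtain ⟨z, rfl, hyz, hzy⟩ := hτ.exists_of_orbitClose h
    refine ⟨p, z, rfl, rfl, hpy.trans hyz, hzy.trans ?_⟩
    rw [Nat.cast_succ, ← τ.apply_zpow_apply]
    exact (hτ.apply_le_apply _ _).2 hyp
  · obtain ⟨p, rfl⟩ := Quotient.exists_rep P
    obtain ⟨y, rfl⟩ := Quotient.exists_rep Y
    -- First `y` is shifted above `p`, then `p` above the result.
    obtain ⟨m, hm⟩ := hτ.cofinal p y
    obtain ⟨n, hn⟩ := hτ.cofinal ((τ ^ m) y) p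
    exact ⟨n, p, (τ ^ m) y, rfl, orbit_zpow (m : ℤ) y, hm, by simpa using hn⟩

end IsGarsideShift

/-! ### Embedding the category in its groupoid of fractions -/

namespace GarsideCat

namespace GarsideStructure

variable {C : Type u} [Category.{v} C] (D : GarsideStructure C)

-- The Ore condition, read off from a join in the lattice of morphisms with target `x`.
include D in
theorem exists_comp_eq_comp_of_target {x y z : C} (f : y ⟶ x) (g : z ⟶ x) :
    ∃ (w : C) (a : w ⟶ y) (b : w ⟶ z), a ≫ f = b ≫ g := by
  obtain ⟨_, hle⟩ := D.lattice_to x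
  obtain ⟨a, ha⟩ := (hle ⟨y, f⟩ _).1 (le_sup_left (b := ⟨z, g⟩))
  obtain ⟨b, hb⟩ := (hle ⟨z, g⟩ _).1 (le_sup_right (a := ⟨y, f⟩))
  exact ⟨_, a, b, ha.symm.trans hb⟩

include D in
theorem hasRightCalculusOfFractions : (⊤ : MorphismProperty C).HasRightCalculusOfFractions where
  exists_rightFraction X Y φ := by
    obtain ⟨w, a, b, h⟩ := D.exists_comp_eq_comp_of_target φ.f φ.s
    exact ⟨.mk a trivial b, h⟩
  ext X Y Y' f₁ f₂ s _ h :=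
    ⟨X, 𝟙 X, trivial, by rw [D.cancellative (𝟙 X) f₁ f₂ s (by rw [h])]⟩

include D in
theorem homMk_injective {x y : C} {f g : x ⟶ y}
    (h : FreeGroupoid.homMk f = FreeGroupoid.homMk g) : f = g := by
  have := D.hasRightCalculusOfFractions
  obtain ⟨w, s, -, hs⟩ := (MorphismProperty.map_eq_iff_precomp (FreeGroupoid.of C) ⊤ f g).1 h
  exact D.cancellative s f g (𝟙 y) (by simpa using hs)

include D in
theorem exists_homMk_comp_eq_homMk {x y : C} (f : FreeGroupoid.mk x ⟶ FreeGroupoid.mk y) :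
    ∃ (w : C) (s : w ⟶ x) (g : w ⟶ y), FreeGroupoid.homMk s ≫ f = FreeGroupoid.homMk g := by
  have := D.hasRightCalculusOfFractions
  obtain ⟨φ, rfl⟩ := Localization.exists_rightFraction (FreeGroupoid.of C) ⊤ f
  exact ⟨_, φ.s, φ.f, φ.map_s_comp_map _ _⟩

theorem homMk_comp {x y z : C} (f : x ⟶ y) (g : y ⟶ z) :
    FreeGroupoid.homMk (f ≫ g) = FreeGroupoid.homMk f ≫ FreeGroupoid.homMk g :=
  (FreeGroupoid.of C).map_comp f g

/-! ### The lattice of groupoid morphisms with fixed source -/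

variable (x : C)

/-- The order on `L_x`: `f ≤ g` if `g = f s` with `s` in `C`. -/
def LLE (f g : D.L x) : Prop := ∃ s : f.1 ⟶ g.1, g.2 = f.2 ≫ FreeGroupoid.homMk s

variable {x}

theorem LLE.refl (f : D.L x) : D.LLE x f f := ⟨𝟙 _, by simp [FreeGroupoid.homMk]⟩

variable {D} in
theorem LLE.trans {f g h : D.L x} (hfg : D.LLE x f g) (hgh : D.LLE x g h) : D.LLE x f h := by
  obtain ⟨s, hs⟩ := hfg
  obtain ⟨t, ht⟩ := hgh
  exact ⟨s ≫ t, by rw [ht, hs, Category.assoc, ← homMk_comp]⟩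

/-- Left translation by an element of `L_x`. -/
def translate (h : D.L x) (a : MorphismsFrom h.1) : D.L x := ⟨a.1, h.2 ≫ FreeGroupoid.homMk a.2⟩

theorem translate_le_iff (h : D.L x) (a b : MorphismsFrom h.1) :
    D.LLE x (D.translate h a) (D.translate h b) ↔ PrefixLE a b := by
  constructor
  · rintro ⟨s, hs⟩
    refine ⟨s, D.homMk_injective ((cancel_epi h.2).1 ?_)⟩
    exact hs.trans ((Category.assoc _ _ _).trans
      (congrArg (h.2 ≫ ·) (homMk_comp a.2 s).symm))
  · rintro ⟨s, hs⟩
    refine ⟨s, ?_⟩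
    simp only [translate, hs, homMk_comp, Category.assoc]

theorem exists_translate {h f : D.L x} (hf : D.LLE x h f) :
    ∃ a : MorphismsFrom h.1, f = D.translate h a := by
  obtain ⟨y, f⟩ := f
  obtain ⟨s, hs⟩ := hf
  exact ⟨⟨y, s⟩, by rw [translate, ← hs]⟩

/-- Writing $f^{-1}g=s^{-1}t$ gives the lower bound $fs^{-1}=gt^{-1}$. -/
theorem exists_lower (f g : D.L x) : ∃ h : D.L x, D.LLE x h f ∧ D.LLE x h g := by
  obtain ⟨w, s, t, hst⟩ := D.exists_homMk_comp_eq_homMk (Groupoid.inv f.2 ≫ g.2)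
  refine ⟨⟨w, f.2 ≫ Groupoid.inv (FreeGroupoid.homMk s)⟩, ⟨s, by simp⟩, ⟨t, ?_⟩⟩
  simp [← hst]

theorem translate_id (f : D.L x) : D.translate f ⟨f.1, 𝟙 f.1⟩ = f := by
  simp [translate, FreeGroupoid.homMk]

variable {D}

theorem LLE.antisymm {f g : D.L x} (hfg : D.LLE x f g) (hgf : D.LLE x g f) : f = g := by
  obtain ⟨a, rfl⟩ := D.exists_translate hfg
  obtain ⟨_, hle⟩ := D.lattice_from f.1
  have h1 := (D.translate_le_iff f ⟨f.1, 𝟙 f.1⟩ a).1 (by rwa [translate_id])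
  have h2 := (D.translate_le_iff f a ⟨f.1, 𝟙 f.1⟩).1 (by rwa [translate_id])
  rw [← le_antisymm ((hle _ _).2 h1) ((hle _ _).2 h2), translate_id]

theorem exists_lub (f g : D.L x) : ∃ s : D.L x, ∀ u, D.LLE x s u ↔ D.LLE x f u ∧ D.LLE x g u := by
  obtain ⟨h, hf, hg⟩ := D.exists_lower f g
  obtain ⟨a, rfl⟩ := D.exists_translate hf
  obtain ⟨b, rfl⟩ := D.exists_translate hg
  obtain ⟨_, hle⟩ := D.lattice_from h.1
  refine ⟨D.translate h (a ⊔ b), fun u => ⟨fun hu => ⟨.trans ?_ hu, .trans ?_ hu⟩, ?_⟩⟩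
  · exact (D.translate_le_iff h _ _).2 ((hle _ _).1 le_sup_left)
  · exact (D.translate_le_iff h _ _).2 ((hle _ _).1 le_sup_right)
  · rintro ⟨hau, hbu⟩
    obtain ⟨c, rfl⟩ := D.exists_translate (hf.trans hau)
    rw [translate_le_iff, ← hle] at hau hbu ⊢
    exact sup_le hau hbu

theorem exists_glb (f g : D.L x) : ∃ s : D.L x, ∀ u, D.LLE x u s ↔ D.LLE x u f ∧ D.LLE x u g := by
  obtain ⟨h, hf, hg⟩ := D.exists_lower f g
  obtain ⟨a, rfl⟩ := D.exists_translate hf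
  obtain ⟨b, rfl⟩ := D.exists_translate hg
  obtain ⟨_, hle⟩ := D.lattice_from h.1
  refine ⟨D.translate h (a ⊓ b), fun u => ⟨fun hu => ⟨hu.trans ?_, hu.trans ?_⟩, ?_⟩⟩
  · exact (D.translate_le_iff h _ _).2 ((hle _ _).1 inf_le_left)
  · exact (D.translate_le_iff h _ _).2 ((hle _ _).1 inf_le_right)
  · rintro ⟨hua, hub⟩
    -- The lower bound `u` need not lie above `h`, where the lattice structure is available; its
    -- join with `h` does, and is still below both elements.
    obtain ⟨j, hj⟩ := exists_lub h u
    obtain ⟨hhj, huj⟩ := (hj j).1 (LLE.refl D j)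
    have hja := (hj _).2 ⟨hf, hua⟩
    have hjb := (hj _).2 ⟨hg, hub⟩
    refine huj.trans ?_
    obtain ⟨c, rfl⟩ := D.exists_translate hhj
    rw [translate_le_iff, ← hle] at hja hjb ⊢
    exact le_inf hja hjb

variable (D x) in
/-- The lattice structure on `L_x`. -/
noncomputable abbrev latticeL : Lattice (D.L x) where
  le := D.LLE x
  le_refl := LLE.refl D
  le_trans _ _ _ := LLE.trans
  le_antisymm _ _ := LLE.antisymm
  sup f g := (exists_lub f g).choose
  le_sup_left f g := (((exists_lub f g).choose_spec _).1 (LLE.refl D _)).1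
  le_sup_right f g := (((exists_lub f g).choose_spec _).1 (LLE.refl D _)).2
  sup_le f g u hf hg := ((exists_lub f g).choose_spec u).2 ⟨hf, hg⟩
  inf f g := (exists_glb f g).choose
  inf_le_left f g := (((exists_glb f g).choose_spec _).1 (LLE.refl D _)).1
  inf_le_right f g := (((exists_glb f g).choose_spec _).1 (LLE.refl D _)).2
  le_inf u f g hf hg := ((exists_glb f g).choose_spec u).2 ⟨hf, hg⟩

/-! ### The Garside automorphism as a shift -/

theorem LLE_garsideMap (f : D.L x) : D.LLE x f (D.garsideMap x f) := by
  rw [garsideMap_eq]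
  exact ⟨D.delta f.1, rfl⟩

/-- The complement of `s` in $\Delta$ is the morphism from `g` up to `f` times $\Delta$; conversely,
the factorisation of $\Delta$ descends from the groupoid to the category by `homMk_injective`. -/
theorem isSimple_iff {f g : D.L x} :
    (∃ s : f.1 ⟶ g.1, D.IsSimple s ∧ g.2 = f.2 ≫ FreeGroupoid.homMk s) ↔
      D.LLE x f g ∧ D.LLE x g (D.garsideMap x f) := by
  rw [garsideMap_eq]
  constructor
  · rintro ⟨s, ⟨t, hst⟩, hs⟩
    refine ⟨⟨s, hs⟩, ⟨t, ?_⟩⟩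
    rw [hs, ← hst, Category.assoc, ← homMk_comp]
  · rintro ⟨⟨s, hs⟩, ⟨t, ht⟩⟩
    refine ⟨s, ⟨t, ?_⟩, hs⟩
    apply D.homMk_injective
    rw [hs, Category.assoc, ← homMk_comp] at ht
    exact ((cancel_epi f.2).1 ht).symm

variable (D) in
theorem phi_full : D.phi.Full := by
  let e : C ≌ C := CategoryTheory.Equivalence.mk D.phi D.phiInv (eqToIso D.phi_comp_phiInv.symm)
    (eqToIso D.phiInv_comp_phi)
  exact inferInstanceAs e.functor.Full

theorem garsideMap_LLE_iff {f g : D.L x} :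
    D.LLE x (D.garsideMap x f) (D.garsideMap x g) ↔ D.LLE x f g := by
  have hnat : ∀ s : f.1 ⟶ g.1, FreeGroupoid.homMk (D.delta f.1) ≫ FreeGroupoid.homMk (D.phi.map s) =
      FreeGroupoid.homMk s ≫ FreeGroupoid.homMk (D.delta g.1) :=
    fun s => D.delta_natural (FreeGroupoid.homMk s)
  rw [garsideMap_eq, garsideMap_eq]
  constructor
  · rintro ⟨u, hu⟩
    have := D.phi_full
    obtain ⟨s, rfl⟩ := D.phi.map_surjective u
    refine ⟨s, ?_⟩
    dsimp only at hu
    rw [Category.assoc, hnat, ← Category.assoc] at hu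
    exact (cancel_mono _).1 hu
  · rintro ⟨s, hs⟩
    refine ⟨D.phi.map s, ?_⟩
    dsimp only
    rw [Category.assoc, hnat, hs, Category.assoc]

/-- Induction on length: a unit needs no shift, an atom is simple and needs one, and a product of
two non-units, hence of two shorter morphisms, needs the sum of the shifts of its factors. -/
theorem exists_LLE_pow {f g : D.L x} (h : D.LLE x f g) :
    ∃ n : ℕ, D.LLE x g ((D.garsideAutomorphism x ^ n) f) := by
  obtain ⟨l, hl, hl0⟩ := D.homogeneous
  obtain ⟨s, hs⟩ := h
  induction hn : l s using Nat.strong_induction_on generalizing f g with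
  | _ n ih =>
    subst hn
    by_cases hiso : IsIso s
    · obtain ⟨t, ht, -⟩ := hiso.out
      have hgf : D.LLE x g f := ⟨t, by
        rw [hs, Category.assoc, ← homMk_comp, ht]
        simp [FreeGroupoid.homMk]⟩
      exact ⟨0, hgf⟩
    by_cases hatom : IsAtom s
    · refine ⟨1, ?_⟩
      rw [pow_one]
      exact (isSimple_iff.1 ⟨s, D.atom_simple s hatom, hs⟩).2
    · obtain ⟨z, a, b, rfl, ha, hb⟩ : ∃ (z : C) (a : f.1 ⟶ z) (b : z ⟶ g.1), s = a ≫ b ∧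
          ¬ IsIso a ∧ ¬ IsIso b := by
        simpa [IsAtom, hiso] using hatom
      rw [← hl0] at ha hb
      rw [hl] at ih
      obtain ⟨m, hm⟩ := ih (l a) (by lia) (f := f) (g := ⟨z, f.2 ≫ FreeGroupoid.homMk a⟩) a rfl rfl
      obtain ⟨n, hn⟩ := ih (l b) (by lia) (f := ⟨z, f.2 ≫ FreeGroupoid.homMk a⟩) (g := g) b
        (hs.trans (by rw [homMk_comp, Category.assoc])) rfl
      refine ⟨n + m, hn.trans ?_⟩
      rw [pow_add, Equiv.Perm.mul_apply]
      clear hn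
      induction n with
      | zero => exact hm
      | succ n ihn =>
        rw [pow_succ', Equiv.Perm.mul_apply, Equiv.Perm.mul_apply]
        exact garsideMap_LLE_iff.2 ihn

variable (D x) in
theorem isGarsideShift :
    letI := D.latticeL x
    IsGarsideShift (D.garsideAutomorphism x) := by
  let := D.latticeL x
  refine ⟨fun f g => garsideMap_LLE_iff, LLE_garsideMap, fun f g => ?_⟩
  -- Since `f` and `g` may be incomparable, the bound is applied to `g ≤ f ⊔ g`.
  obtain ⟨n, hn⟩ := exists_LLE_pow (le_sup_right : g ≤ f ⊔ g)
  exact ⟨n, (le_sup_left : f ≤ f ⊔ g).trans hn⟩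

end GarsideStructure

end GarsideCat

theorem theorem5p7 {C : Type u} [Category.{v} C] (D : GarsideCat.GarsideStructure C) (x : C) :
    (D.weakCayleyGraph x).IsWeaklyModular ∧ (D.weakCayleyGraphQuotient x).IsWeaklyModular := by
  let := D.latticeL x
  have hτ := D.isGarsideShift x
  have : Nonempty (D.L x) := ⟨⟨x, 𝟙 _⟩⟩
  have adj_iff : ∀ f g, (D.weakCayleyGraph x).Adj f g ↔ f ≠ g ∧ hτ.Close f g := by
    intro f g
    rw [GarsideCat.GarsideStructure.weakCayleyGraph, SimpleGraph.fromRel_adj,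
      GarsideCat.GarsideStructure.isSimple_iff, GarsideCat.GarsideStructure.isSimple_iff]
    rfl
  exact ⟨hτ.isWeaklyModular _ adj_iff, hτ.isWeaklyModular_orbitQuotient _ adj_iff⟩
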